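/- For a positive integer $n$, let $h_n$ be the maximum value of a determinant of order $n$ all of whose entries are $0$ or $1$, and let $\nu_n$ be the maximum volume of an $n$-dimensional simplex contained in the unit cube $Q_n=[0,1]^n\subset\mathbb{R}^n$. There exist constants $c, c_1>0$, not depending on $n$, such that for every integer $n\ge 1$ $$\frac{h_{n+1}}{h_n}\ \ge\ c\sqrt{n},\qquad \frac{\nu_n}{\nu_{n+1}}\ \le\ c_1\sqrt{n}.$$ -/

import Mathlib

/-- The set of all values of determinants of order `n` with entries `0` or `1`. -/
def zeroOneDets (n : ℕ) : Set ℝ :=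
  {d | ∃ A : Matrix (Fin n) (Fin n) ℝ, (∀ i j, A i j = 0 ∨ A i j = 1) ∧ A.det = d}

/-- `h_n`: the maximum of a determinant of order `n` with entries `0` or `1`
(the maximum is attained, see `isGreatest_maxDet`). -/
noncomputable def maxDet (n : ℕ) : ℝ := sSup (zeroOneDets n)

/-- The unit cube `Q_n = [0,1]^n` in `ℝⁿ`. -/
def unitCube (n : ℕ) : Set (Fin n → ℝ) := {x | ∀ i, 0 ≤ x i ∧ x i ≤ 1}

/-- The set of all volumes (Lebesgue measures) of `n`-dimensional (nondegenerate) simplices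
contained in `Q_n`; the simplex is the convex hull of its `n + 1` affinely independent vertices. -/
def simplexVolumes (n : ℕ) : Set ℝ :=
  {v | ∃ S : Affine.Simplex ℝ (Fin n → ℝ) n,
    convexHull ℝ (Set.range S.points) ⊆ unitCube n ∧
    MeasureTheory.volume.real (convexHull ℝ (Set.range S.points)) = v}

/-- `ν_n`: the maximum volume of an `n`-dimensional simplex contained in `Q_n`
(the maximum is attained, see `isGreatest_maxSimplexVolume`). -/
noncomputable def maxSimplexVolume (n : ℕ) : ℝ := sSup (simplexVolumes n)

theorem isGreatest_maxDet (n : ℕ) : IsGreatest (zeroOneDets n) (maxDet n) := by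
  have hfin : (zeroOneDets n).Finite := by
    have h1 : {A : Matrix (Fin n) (Fin n) ℝ | ∀ i j, A i j = 0 ∨ A i j = 1}.Finite := by
      have := Set.Finite.pi' (ι := Fin n) (fun _ => Set.Finite.pi' (ι := Fin n)
        (fun _ => Set.toFinite ({0, 1} : Set ℝ)))
      exact this
    refine (h1.image Matrix.det).subset ?_
    rintro d ⟨A, hA, rfl⟩
    exact ⟨A, hA, rfl⟩
  have hne : (zeroOneDets n).Nonempty := by
    refine ⟨1, 1, fun i j => ?_, Matrix.det_one⟩
    rw [Matrix.one_apply]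
    split_ifs
    · exact Or.inr rfl
    · exact Or.inl rfl
  exact ⟨hne.csSup_mem hfin, fun x hx => le_csSup hfin.bddAbove hx⟩

theorem maxDet_pos (n : ℕ) : 0 < maxDet n := by
  refine lt_of_lt_of_le one_pos ((isGreatest_maxDet n).2 ⟨1, fun i j => ?_, Matrix.det_one⟩)
  rw [Matrix.one_apply]
  split_ifs
  · exact Or.inr rfl
  · exact Or.inl rfl

theorem convex_unitCube (n : ℕ) : Convex ℝ (unitCube n) := by
  have : unitCube n = Set.Icc 0 1 := by
    ext x
    simp only [unitCube, Set.mem_ofPred_eq, Set.mem_Icc, Pi.le_def, forall_and]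
    rfl
  rw [this]
  exact convex_Icc 0 1

theorem isCompact_unitCube (n : ℕ) : IsCompact (unitCube n) := by
  have : unitCube n = Set.Icc 0 1 := by
    ext x
    simp only [unitCube, Set.mem_ofPred_eq, Set.mem_Icc, Pi.le_def, forall_and]
    rfl
  rw [this]
  exact isCompact_Icc

/-- The convex hull of `n + 1` points of `ℝⁿ` has positive volume iff the points are
affinely independent. -/
theorem volume_hull_pos_iff {n : ℕ} (p : Fin (n + 1) → (Fin n → ℝ)) :
    0 < MeasureTheory.volume.real (convexHull ℝ (Set.range p)) ↔ AffineIndependent ℝ p := by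
  have hcpt : IsCompact (convexHull ℝ (Set.range p)) :=
    (Set.finite_range p).isCompact_convexHull ℝ
  constructor
  · intro h
    rw [affineIndependent_iff_finrank_vectorSpan_eq ℝ p (n := n) (by simp)]
    have htop : affineSpan ℝ (Set.range p) = ⊤ := by
      by_contra hne
      have h0 := MeasureTheory.Measure.addHaar_affineSubspace
        (MeasureTheory.volume : MeasureTheory.Measure (Fin n → ℝ)) _ hne
      have h1 := MeasureTheory.measure_mono_null
        (convexHull_subset_affineSpan (𝕜 := ℝ) (Set.range p)) h0
      rw [MeasureTheory.measureReal_def, h1] at h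
      simp at h
    rw [← direction_affineSpan, htop, AffineSubspace.direction_top, finrank_top,
      Module.finrank_fin_fun]
  · intro h
    have htop : affineSpan ℝ (Set.range p) = ⊤ := by
      rw [h.affineSpan_eq_top_iff_card_eq_finrank_add_one]
      simp
    have hint := interior_convexHull_nonempty_iff_affineSpan_eq_top.2 htop
    exact ENNReal.toReal_pos
      (MeasureTheory.Measure.measure_pos_of_nonempty_interior _ hint).ne'
      hcpt.measure_lt_top.ne

theorem continuous_volume_hull (n : ℕ) :
    Continuous fun p : Fin (n + 1) → (Fin n → ℝ) =>
      MeasureTheory.volume.real (convexHull ℝ (Set.range p)) := by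
  let q : Fin (n + 1) → (Fin n → ℝ) := Fin.cons 0 fun i => Pi.single i 1
  let M : (Fin (n + 1) → (Fin n → ℝ)) → Matrix (Fin n) (Fin n) ℝ :=
    fun p => Matrix.of fun i j => p j.succ i - p 0 i
  have key : ∀ p : Fin (n + 1) → (Fin n → ℝ),
      MeasureTheory.volume.real (convexHull ℝ (Set.range p)) =
        |(M p).det| * MeasureTheory.volume.real (convexHull ℝ (Set.range q)) := by
    intro p
    have hp : Set.range p = (fun x => p 0 + x) '' (Matrix.toLin' (M p) '' Set.range q) := by
      rw [← Set.range_comp, ← Set.range_comp]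
      congr 1
      funext k
      refine Fin.cases ?_ (fun j => ?_) k
      · simp [q]
      · funext i
        simp [q, M]
    have hh : convexHull ℝ (Set.range p) =
        (fun x => p 0 + x) '' (Matrix.toLin' (M p) '' convexHull ℝ (Set.range q)) := by
      rw [hp, LinearMap.image_convexHull]
      have := convexHull_vadd (𝕜 := ℝ) (p 0) (Matrix.toLin' (M p) '' Set.range q)
      exact this
    rw [hh, MeasureTheory.measureReal_def, Set.image_add_left,
      MeasureTheory.measure_preimage_add, MeasureTheory.Measure.addHaar_image_linearMap,
      ENNReal.toReal_mul, ENNReal.toReal_ofReal (abs_nonneg _), LinearMap.det_toLin',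
      MeasureTheory.measureReal_def]
  rw [funext key]
  have hM : Continuous M := by
    refine continuous_matrix fun i j => ?_
    simp only [M, Matrix.of_apply]
    fun_prop
  exact (hM.matrix_det.abs).mul continuous_const

theorem isGreatest_maxSimplexVolume (n : ℕ) :
    IsGreatest (simplexVolumes n) (maxSimplexVolume n) := by
  obtain ⟨p, hp, hmax⟩ := (isCompact_univ_pi
    (fun _ : Fin (n + 1) => isCompact_unitCube n)).exists_isMaxOn
    ⟨fun _ _ => 0, fun _ _ _ => ⟨le_rfl, zero_le_one⟩⟩ (continuous_volume_hull n).continuousOn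
  have hindep : AffineIndependent ℝ p := by
    let q : Fin (n + 1) → (Fin n → ℝ) := Fin.cons 0 fun i => Pi.single i 1
    have hq : AffineIndependent ℝ q := by
      rw [affineIndependent_iff_linearIndependent_vsub ℝ q 0]
      have hb : LinearIndependent ℝ (fun i : Fin n => (Pi.single i 1 : Fin n → ℝ)) := by
        have h := (Pi.basisFun ℝ (Fin n)).linearIndependent
        have he : ⇑(Pi.basisFun ℝ (Fin n)) = fun i => (Pi.single i 1 : Fin n → ℝ) :=
          funext fun i => Pi.basisFun_apply ℝ (Fin n) i
        rwa [he] at h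
      refine (linearIndependent_equiv (finSuccAboveEquiv (0 : Fin (n + 1)))).1 ?_
      have he : (fun x : {x : Fin (n + 1) // x ≠ 0} => (q x -ᵥ q 0 : Fin n → ℝ)) ∘
          (finSuccAboveEquiv (0 : Fin (n + 1))) = fun i => (Pi.single i 1 : Fin n → ℝ) := by
        funext y
        simp [q, finSuccAboveEquiv_apply]
      rw [he]
      exact hb
    have hqc : q ∈ Set.univ.pi fun _ : Fin (n + 1) => unitCube n := by
      intro k _
      refine Fin.cases ?_ (fun j => ?_) k
      · intro i; simp [q]
      · intro i
        by_cases h : i = j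
        · subst h; simp [q]
        · simp [q, h]
    exact (volume_hull_pos_iff p).1 (((volume_hull_pos_iff q).2 hq).trans_le (hmax hqc))
  have hg : IsGreatest (simplexVolumes n)
      (MeasureTheory.volume.real (convexHull ℝ (Set.range p))) := by
    refine ⟨⟨⟨p, hindep⟩, convexHull_min ?_ (convex_unitCube n), rfl⟩, ?_⟩
    · rintro _ ⟨k, rfl⟩
      exact hp k trivial
    · rintro v ⟨S, hS, rfl⟩
      exact hmax (fun k _ => hS (subset_convexHull ℝ _ ⟨k, rfl⟩))
  rw [maxSimplexVolume, hg.csSup_eq]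
  exact hg

theorem maxSimplexVolume_pos (n : ℕ) : 0 < maxSimplexVolume n := by
  obtain ⟨S, -, hS⟩ := (isGreatest_maxSimplexVolume n).1
  rw [← hS]
  exact (volume_hull_pos_iff S.points).2 S.independent

/-! Bordering a maximal 0-1 matrix A by a row x, a column b and a corner 0 multiplies |det A| by |x
A⁻¹ b|, so x and b need only make this form of order √n. A suitable b recovers half the ℓ¹ norm of x
A⁻¹. The rows of A have length at most √n and A A⁻¹ = 1, so each of the n columns of A⁻¹ has length
at least 1/√n; by Khinchine (`mul_sqrt_le_sum_abs_signedSum`) a random signed sum of the rows of A⁻¹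
has mean ℓ¹ norm at least √(n/3).

For volumes, `maxSimplexVolume_eq` factors ν_n as h_n times the volume of the corner simplex,
because separate convexity pushes vertices of a simplex to vertices of the cube. Consecutive corner
volumes have ratio at most 3(n + 1), and dividing by the determinant ratio leaves order √n. -/

/-! ### Moments of random signed sums -/

/-- The sum of the `a i` over `s`, with a plus sign for `i ∈ t` and a minus sign for `i ∉ t`. -/
noncomputable def signedSum {ι : Type*} [DecidableEq ι] (a : ι → ℝ) (s t : Finset ι) : ℝ :=
  ∑ i ∈ s, if i ∈ t then a i else -a i

section SignedSum

variable {ι : Type*} [DecidableEq ι] (a : ι → ℝ)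

theorem signedSum_insert_left {s t : Finset ι} {i : ι} (hi : i ∉ s) (ht : t ⊆ s) :
    signedSum a (insert i s) t = signedSum a s t - a i := by
  have : i ∉ t := fun h => hi (ht h)
  rw [signedSum, Finset.sum_insert hi, if_neg this, signedSum]
  ring

theorem signedSum_insert_insert {s t : Finset ι} {i : ι} (hi : i ∉ s) :
    signedSum a (insert i s) (insert i t) = signedSum a s t + a i := by
  rw [signedSum, Finset.sum_insert hi, if_pos (Finset.mem_insert_self i t), signedSum, add_comm]
  congr 1
  refine Finset.sum_congr rfl fun j hj => ?_
  have : j ≠ i := fun h => hi (h ▸ hj)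
  simp [this]

theorem sum_powerset_insert_signedSum (f : ℝ → ℝ) {s : Finset ι} {i : ι} (hi : i ∉ s) :
    ∑ t ∈ (insert i s).powerset, f (signedSum a (insert i s) t) =
      ∑ t ∈ s.powerset, (f (signedSum a s t - a i) + f (signedSum a s t + a i)) := by
  rw [Finset.sum_powerset_insert hi, Finset.sum_add_distrib]
  congr 1
  · refine Finset.sum_congr rfl fun t ht => ?_
    rw [signedSum_insert_left a hi (Finset.mem_powerset.1 ht)]
  · refine Finset.sum_congr rfl fun t _ => ?_
    rw [signedSum_insert_insert a hi]

theorem sum_signedSum_sq (s : Finset ι) :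
    ∑ t ∈ s.powerset, signedSum a s t ^ 2 = 2 ^ s.card * ∑ i ∈ s, a i ^ 2 := by
  induction s using Finset.induction_on with
  | empty => simp [signedSum]
  | insert i s hi ih =>
    rw [sum_powerset_insert_signedSum a (fun x => x ^ 2) hi, Finset.sum_insert hi,
      Finset.card_insert_of_notMem hi]
    have h : ∀ t ∈ s.powerset, ((signedSum a s t - a i) ^ 2 + (signedSum a s t + a i) ^ 2) =
        2 * signedSum a s t ^ 2 + 2 * a i ^ 2 := fun t _ => by ring
    rw [Finset.sum_congr rfl h, Finset.sum_add_distrib, ← Finset.mul_sum, ih, Finset.sum_const,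
      Finset.card_powerset, nsmul_eq_mul]
    push_cast
    ring

theorem sum_signedSum_pow_four_le (s : Finset ι) :
    ∑ t ∈ s.powerset, signedSum a s t ^ 4 ≤ 3 * 2 ^ s.card * (∑ i ∈ s, a i ^ 2) ^ 2 := by
  induction s using Finset.induction_on with
  | empty => simp [signedSum]
  | insert i s hi ih =>
    rw [sum_powerset_insert_signedSum a (fun x => x ^ 4) hi, Finset.sum_insert hi,
      Finset.card_insert_of_notMem hi]
    have h : ∀ t ∈ s.powerset, ((signedSum a s t - a i) ^ 4 + (signedSum a s t + a i) ^ 4) =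
        2 * signedSum a s t ^ 4 + 12 * a i ^ 2 * signedSum a s t ^ 2 + 2 * a i ^ 4 :=
      fun t _ => by ring
    rw [Finset.sum_congr rfl h, Finset.sum_add_distrib, Finset.sum_add_distrib, ← Finset.mul_sum,
      ← Finset.mul_sum, sum_signedSum_sq, Finset.sum_const, Finset.card_powerset, nsmul_eq_mul]
    push_cast
    have hp : (0 : ℝ) ≤ 2 ^ s.card * a i ^ 4 := by positivity
    rw [pow_succ]
    linear_combination 2 * ih + 4 * hp

/-- Khinchine's inequality: the mean of `|∑ ± a i|` is at least `√((∑ a i ^ 2) / 3)`. -/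
theorem mul_sqrt_le_sum_abs_signedSum (s : Finset ι) :
    2 ^ s.card * √((∑ i ∈ s, a i ^ 2) / 3) ≤ ∑ t ∈ s.powerset, |signedSum a s t| := by
  set Q := ∑ i ∈ s, a i ^ 2 with hQ
  have hQ0 : 0 ≤ Q := Finset.sum_nonneg fun i _ => sq_nonneg _
  rcases hQ0.eq_or_lt with h0 | hpos
  · rw [← h0]
    simpa using Finset.sum_nonneg fun t (_ : t ∈ s.powerset) => abs_nonneg (signedSum a s t)
  set r := √(Q / 3) with hr
  have hr0 : 0 < r := Real.sqrt_pos.2 (by positivity)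
  have hrQ : Q = 3 * r ^ 2 := by rw [hr, Real.sq_sqrt (by positivity)]; ring
  -- A quartic minorant of |x|, touching it at |x| = 0 and 3r. The second moment is 3r² and the
  -- fourth at most 27r⁴, so averaging gives 81r⁴ - 27r⁴ = 54r⁴.
  have hpt : ∀ x : ℝ, (27 * r ^ 2 * x ^ 2 - x ^ 4) ≤ 54 * r ^ 3 * |x| := by
    intro x
    have hx := abs_nonneg x
    have h2 : x ^ 2 = |x| ^ 2 := (sq_abs x).symm
    have h4 : x ^ 4 = |x| ^ 4 := by rw [show x ^ 4 = (x ^ 2) ^ 2 by ring, h2]; ring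
    rw [h2, h4]
    have : 0 ≤ |x| * ((|x| - 3 * r) ^ 2 * (|x| + 6 * r)) := by positivity
    linear_combination this
  have hsum := Finset.sum_le_sum fun t (_ : t ∈ s.powerset) => hpt (signedSum a s t)
  rw [Finset.sum_sub_distrib, ← Finset.mul_sum, ← Finset.mul_sum, sum_signedSum_sq, ← hQ] at hsum
  have h4 := sum_signedSum_pow_four_le a s
  rw [← hQ] at h4
  rw [hrQ] at hsum h4
  have : 54 * r ^ 3 * (2 ^ s.card * r) ≤ 54 * r ^ 3 * ∑ t ∈ s.powerset, |signedSum a s t| := by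
    linear_combination hsum + h4
  exact le_of_mul_le_mul_left this (by positivity)

end SignedSum

/-! ### Bordering 0-1 matrices -/

/-- Swapping two rows flips a negative sign; for n ≤ 1 no determinant is negative. -/
theorem abs_det_le_maxDet {n : ℕ} {A : Matrix (Fin n) (Fin n) ℝ}
    (hA : ∀ i j, A i j = 0 ∨ A i j = 1) : |A.det| ≤ maxDet n := by
  rcases le_or_gt 0 A.det with h | h
  · rw [abs_of_nonneg h]
    exact (isGreatest_maxDet n).2 ⟨A, hA, rfl⟩
  rw [abs_of_neg h]
  match n, A, hA, h with
  | 0, A, hA, h => simp at h; linarith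
  | 1, A, hA, h =>
    rw [Matrix.det_fin_one] at h
    rcases hA 0 0 with h' | h' <;> linarith
  | n + 2, A, hA, h =>
    refine (isGreatest_maxDet _).2 ⟨A.submatrix (Equiv.swap 0 1) id, fun i j => hA _ _, ?_⟩
    rw [Matrix.det_permute, Equiv.Perm.sign_swap (by simp)]
    simp

/-- Bordering a nonsingular `0`-`1` matrix by a column `b`, a row `x` and a corner entry `0`. -/
theorem abs_det_mul_le_maxDet_succ {n : ℕ} {A : Matrix (Fin n) (Fin n) ℝ}
    (hA : ∀ i j, A i j = 0 ∨ A i j = 1) (hdet : A.det ≠ 0) {x b : Fin n → ℝ}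
    (hx : ∀ i, x i = 0 ∨ x i = 1) (hb : ∀ i, b i = 0 ∨ b i = 1) :
    |A.det| * |Matrix.vecMul x A⁻¹ ⬝ᵥ b| ≤ maxDet (n + 1) := by
  let B : Matrix (Fin n ⊕ Fin 1) (Fin n ⊕ Fin 1) ℝ :=
    Matrix.fromBlocks A (Matrix.replicateCol (Fin 1) b) (Matrix.replicateRow (Fin 1) x) 0
  have hB : ∀ i j, B i j = 0 ∨ B i j = 1 := by
    rintro (i | i) (j | j)
    · exact hA i j
    · exact hb i
    · exact hx j
    · exact Or.inl rfl
  have hBdet : B.det = A.det * -(Matrix.vecMul x A⁻¹ ⬝ᵥ b) := by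
    have : Invertible A := A.invertibleOfIsUnitDet hdet.isUnit
    -- The Schur complement of A is the 1 × 1 matrix 0 - x A⁻¹ b.
    rw [Matrix.det_fromBlocks₁₁, Matrix.invOf_eq_nonsing_inv]
    congr 1
    rw [Matrix.det_fin_one, ← Matrix.replicateRow_vecMul]
    simp [Matrix.mul_apply, dotProduct]
  have h := abs_det_le_maxDet (A := Matrix.reindex finSumFinEquiv finSumFinEquiv B)
    fun i j => hB _ _
  rwa [Matrix.det_reindex_self, hBdet, abs_mul, abs_neg] at h

/-- The positive and negative parts of v add up to the ℓ¹ norm, so the indicator of one of the two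
supports captures half. -/
theorem exists_zero_one_half_sum_abs_le {n : ℕ} (v : Fin n → ℝ) :
    ∃ b : Fin n → ℝ, (∀ i, b i = 0 ∨ b i = 1) ∧ (∑ i, |v i|) / 2 ≤ |v ⬝ᵥ b| := by
  let b : Fin n → ℝ := fun i => if 0 ≤ v i then 1 else 0
  have hb : ∀ i, b i = 0 ∨ b i = 1 := fun i => by
    by_cases h : 0 ≤ v i <;> simp [b, h]
  have hsum : ∑ i, |v i| = v ⬝ᵥ b - v ⬝ᵥ (1 - b) := by
    rw [dotProduct, dotProduct, ← Finset.sum_sub_distrib]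
    refine Finset.sum_congr rfl fun i _ => ?_
    by_cases h : 0 ≤ v i
    · simp [b, h, abs_of_nonneg h]
    · simp [b, h, abs_of_neg (not_le.1 h)]
  rcases le_total (∑ i, |v i|) (2 * |v ⬝ᵥ b|) with h | h
  · exact ⟨b, hb, by linarith⟩
  · refine ⟨1 - b, fun i => ?_, ?_⟩
    · rcases hb i with h | h <;> simp [h]
    · have h1 := le_abs_self (v ⬝ᵥ b)
      have h2 := neg_le_abs (v ⬝ᵥ (1 - b))
      linarith

/-- Cauchy–Schwarz: row j of A, of squared length at most n, pairs to 1 with column j of A⁻¹. -/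
theorem inv_le_sum_sq_inv_apply {n : ℕ} {A : Matrix (Fin n) (Fin n) ℝ}
    (hA : ∀ i j, A i j = 0 ∨ A i j = 1) (hdet : A.det ≠ 0) (j : Fin n) :
    (n : ℝ)⁻¹ ≤ ∑ i, A⁻¹ i j ^ 2 := by
  have hn : (0 : ℝ) < n := by exact_mod_cast j.pos
  have h1 : ∑ i, A j i * A⁻¹ i j = 1 := by
    rw [← Matrix.mul_apply, Matrix.mul_nonsing_inv A hdet.isUnit, Matrix.one_apply_eq]
  have h2 : ∑ i, A j i ^ 2 ≤ n := by
    refine (Finset.sum_le_sum fun i _ => (?_ : A j i ^ 2 ≤ 1)).trans (by simp)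
    rcases hA j i with h | h <;> simp [h]
  have h3 := Finset.sum_mul_sq_le_sq_mul_sq Finset.univ (fun i => A j i) fun i => A⁻¹ i j
  rw [h1] at h3
  have h4 : 0 ≤ ∑ i, A⁻¹ i j ^ 2 := Finset.sum_nonneg fun i _ => sq_nonneg _
  rw [inv_le_iff_one_le_mul₀' hn]
  nlinarith

theorem exists_zero_one_sqrt_le_sum_abs_vecMul_inv {n : ℕ} {A : Matrix (Fin n) (Fin n) ℝ}
    (hA : ∀ i j, A i j = 0 ∨ A i j = 1) (hdet : A.det ≠ 0) :
    ∃ x : Fin n → ℝ, (∀ i, x i = 0 ∨ x i = 1) ∧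
      √(n / 3) / 2 ≤ ∑ j, |Matrix.vecMul x A⁻¹ j| := by
  obtain ⟨t, -, ht⟩ : ∃ t ∈ (Finset.univ : Finset (Fin n)).powerset,
      √(n / 3) ≤ ∑ j, |signedSum (fun i => A⁻¹ i j) Finset.univ t| := by
    refine Finset.exists_le_of_sum_le ⟨∅, by simp⟩ ?_
    rw [Finset.sum_comm, Finset.sum_const, nsmul_eq_mul, Finset.card_powerset]
    have hj : ∀ j ∈ (Finset.univ : Finset (Fin n)),
        2 ^ n * √((n : ℝ)⁻¹ / 3) ≤
          ∑ t ∈ (Finset.univ : Finset (Fin n)).powerset,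
            |signedSum (fun i => A⁻¹ i j) Finset.univ t| := by
      intro j _
      refine le_trans ?_ (mul_sqrt_le_sum_abs_signedSum _ _)
      have := inv_le_sum_sq_inv_apply hA hdet j
      rw [Finset.card_univ, Fintype.card_fin]
      gcongr
    refine le_trans (le_of_eq ?_) (Finset.sum_le_sum hj)
    rw [Finset.sum_const, nsmul_eq_mul, Finset.card_univ, Fintype.card_fin]
    rcases n.eq_zero_or_pos with rfl | hn
    · simp
    have hn' : (0 : ℝ) < n := by exact_mod_cast hn
    have : √((n : ℝ) / 3) = n * √((n : ℝ)⁻¹ / 3) := by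
      rw [Real.sqrt_eq_iff_mul_self_eq (by positivity) (by positivity),
        mul_mul_mul_comm, Real.mul_self_sqrt (by positivity)]
      field_simp
    rw [this]
    push_cast
    ring
  let x : Fin n → ℝ := fun i => if i ∈ t then 1 else 0
  have hx : ∀ i, x i = 0 ∨ x i = 1 := fun i => by
    by_cases h : i ∈ t <;> simp [x, h]
  -- A sign vector is x - (1 - x), so one of these two 0-1 vectors keeps half of the norm.
  have hdiff : ∀ j, signedSum (fun i => A⁻¹ i j) Finset.univ t =
      Matrix.vecMul x A⁻¹ j - Matrix.vecMul (1 - x) A⁻¹ j := by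
    intro j
    rw [signedSum, Matrix.vecMul, Matrix.vecMul, dotProduct, dotProduct, ← Finset.sum_sub_distrib]
    refine Finset.sum_congr rfl fun i _ => ?_
    by_cases h : i ∈ t <;> simp [x, h]
  have hle : √(n / 3) ≤
      ∑ j, |Matrix.vecMul x A⁻¹ j| + ∑ j, |Matrix.vecMul (1 - x) A⁻¹ j| := by
    rw [← Finset.sum_add_distrib]
    refine ht.trans (Finset.sum_le_sum fun j _ => ?_)
    rw [hdiff j]
    exact abs_sub _ _
  rcases le_total (√(n / 3)) (2 * ∑ j, |Matrix.vecMul x A⁻¹ j|) with h | h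
  · exact ⟨x, hx, by linarith⟩
  · refine ⟨1 - x, fun i => ?_, by linarith⟩
    rcases hx i with h | h <;> simp [h]

theorem maxDet_mul_sqrt_le_maxDet_succ (n : ℕ) :
    maxDet n * (√(n / 3) / 4) ≤ maxDet (n + 1) := by
  obtain ⟨A, hA, hmax⟩ := (isGreatest_maxDet n).1
  have hpos : 0 < A.det := hmax ▸ maxDet_pos n
  obtain ⟨x, hx, hxs⟩ := exists_zero_one_sqrt_le_sum_abs_vecMul_inv hA hpos.ne'
  obtain ⟨b, hb, hbs⟩ := exists_zero_one_half_sum_abs_le (Matrix.vecMul x A⁻¹)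
  refine le_trans ?_ (abs_det_mul_le_maxDet_succ hA hpos.ne' hx hb)
  rw [← hmax, abs_of_pos hpos]
  gcongr
  linarith

/-! ### Simplices in the cube and determinants -/

/-- The vertices `0, e₁, …, eₙ` of the corner simplex of the unit cube. -/
def cornerVertices (n : ℕ) : Fin (n + 1) → (Fin n → ℝ) := Fin.cons 0 fun i => Pi.single i 1

/-- The volume of the corner simplex of the unit cube. -/
noncomputable def cornerVolume (n : ℕ) : ℝ :=
  MeasureTheory.volume.real (convexHull ℝ (Set.range (cornerVertices n)))

theorem convexHull_cornerVertices (n : ℕ) :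
    convexHull ℝ (Set.range (cornerVertices n)) = {x | (∀ i, 0 ≤ x i) ∧ ∑ i, x i ≤ 1} := by
  apply Set.Subset.antisymm
  · refine convexHull_min ?_ ?_
    · rintro _ ⟨k, rfl⟩
      refine Fin.cases ?_ (fun j => ?_) k
      · simp [cornerVertices]
      · refine ⟨fun i => ?_, ?_⟩
        · by_cases h : i = j
          · subst h; simp [cornerVertices]
          · simp [cornerVertices, h]
        · simp [cornerVertices]
    · rintro x ⟨hx, hxs⟩ y ⟨hy, hys⟩ a b ha hb hab
      refine ⟨fun i => ?_, ?_⟩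
      · have := hx i
        have := hy i
        simp only [Pi.add_apply, Pi.smul_apply, smul_eq_mul]
        positivity
      · simp only [Pi.add_apply, Pi.smul_apply, smul_eq_mul, Finset.sum_add_distrib,
          ← Finset.mul_sum]
        nlinarith
  · rintro x ⟨hx, hxs⟩
    have h := (convex_convexHull ℝ (Set.range (cornerVertices n))).sum_mem
      (t := Finset.univ) (w := Fin.cons (1 - ∑ i, x i) x) (z := cornerVertices n)
      (fun k _ => by
        refine Fin.cases ?_ (fun j => ?_) k
        · simpa using hxs
        · simpa using hx j)
      (by rw [Fin.sum_univ_succ]; simp)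
      (fun k _ => subset_convexHull ℝ _ ⟨k, rfl⟩)
    convert h using 1
    rw [Fin.sum_univ_succ]
    funext i
    simp [cornerVertices, Finset.sum_apply, Pi.single_apply]

/-- The matrix whose columns are the edges `p (j + 1) - p 0`. -/
def edgeMatrix {n : ℕ} (p : Fin (n + 1) → (Fin n → ℝ)) : Matrix (Fin n) (Fin n) ℝ :=
  Matrix.of fun i j => p j.succ i - p 0 i

theorem volume_hull_eq {n : ℕ} (p : Fin (n + 1) → (Fin n → ℝ)) :
    MeasureTheory.volume.real (convexHull ℝ (Set.range p)) =
      |(edgeMatrix p).det| * cornerVolume n := by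
  have hp : Set.range p =
      (fun x => p 0 + x) '' (Matrix.toLin' (edgeMatrix p) '' Set.range (cornerVertices n)) := by
    rw [← Set.range_comp, ← Set.range_comp]
    congr 1
    funext k
    refine Fin.cases ?_ (fun j => ?_) k
    · simp [cornerVertices]
    · funext i
      simp [cornerVertices, edgeMatrix]
  have hh : convexHull ℝ (Set.range p) = (fun x => p 0 + x) ''
      (Matrix.toLin' (edgeMatrix p) '' convexHull ℝ (Set.range (cornerVertices n))) := by
    rw [hp, LinearMap.image_convexHull]
    exact convexHull_vadd (𝕜 := ℝ) (p 0) (Matrix.toLin' (edgeMatrix p) '' _)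
  rw [hh, MeasureTheory.measureReal_def, Set.image_add_left,
    MeasureTheory.measure_preimage_add, MeasureTheory.Measure.addHaar_image_linearMap,
    ENNReal.toReal_mul, ENNReal.toReal_ofReal (abs_nonneg _), LinearMap.det_toLin',
    cornerVolume, MeasureTheory.measureReal_def]

/-- The matrix with rows `(1, p k)`. -/
def homogeneousMatrix {n : ℕ} (p : Fin (n + 1) → (Fin n → ℝ)) :
    Matrix (Fin (n + 1)) (Fin (n + 1)) ℝ :=
  Matrix.of fun k => Fin.cons 1 (p k)

/-- Subtract the first row from the others. In the homogeneous form each vertex, including `p 0`,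
occupies a single row, which makes the determinant affine in each vertex. -/
theorem det_homogeneousMatrix {n : ℕ} (p : Fin (n + 1) → (Fin n → ℝ)) :
    (homogeneousMatrix p).det = (edgeMatrix p).det := by
  let B : Matrix (Fin (n + 1)) (Fin (n + 1)) ℝ :=
    Matrix.of (Fin.cons (Fin.cons 1 (p 0)) fun k => Fin.cons 0 (p k.succ - p 0))
  have hAB : (homogeneousMatrix p).det = B.det := by
    refine Matrix.det_eq_of_forall_row_eq_smul_add_const (Fin.cons 0 fun _ => 1) 0 (by simp) ?_
    intro i j
    refine Fin.cases ?_ (fun i => ?_) i <;> refine Fin.cases ?_ (fun j => ?_) j <;>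
      simp [B, homogeneousMatrix]
  rw [hAB, Matrix.det_succ_column_zero, Fin.sum_univ_succ, ← Matrix.det_transpose (edgeMatrix p)]
  have : (B.submatrix Fin.succ Fin.succ) = (edgeMatrix p).transpose := by
    ext i j
    simp [B, edgeMatrix]
  simp [B] at this ⊢
  simp [this]

theorem convexOn_abs_det_edgeMatrix_update {n : ℕ} (p : Fin (n + 1) → (Fin n → ℝ))
    (k : Fin (n + 1)) :
    ConvexOn ℝ Set.univ fun x => |(edgeMatrix (Function.update p k x)).det| := by
  refine ⟨convex_univ, fun x _ y _ a b ha hb hab => ?_⟩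
  have hupd : ∀ z, homogeneousMatrix (Function.update p k z) =
      (homogeneousMatrix p).updateRow k (Fin.cons 1 z) := by
    intro z
    ext i j
    by_cases h : i = k
    · subst h; simp [homogeneousMatrix]
    · simp [homogeneousMatrix, h]
  have hrow : (Fin.cons 1 (a • x + b • y) : Fin (n + 1) → ℝ) =
      a • (Fin.cons 1 x : Fin (n + 1) → ℝ) + b • (Fin.cons 1 y : Fin (n + 1) → ℝ) := by
    funext j
    refine Fin.cases ?_ (fun j => ?_) j
    · simp [hab]
    · simp
  simp only [← det_homogeneousMatrix, hupd]
  rw [hrow, Matrix.det_updateRow_add, Matrix.det_updateRow_smul, Matrix.det_updateRow_smul]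
  refine (abs_add_le _ _).trans ?_
  rw [abs_mul, abs_mul, abs_of_nonneg ha, abs_of_nonneg hb, smul_eq_mul, smul_eq_mul]

/-- Maximum principle for separately convex functions. -/
theorem exists_le_of_forall_convexOn_update {ι E : Type*} [Fintype ι] [DecidableEq ι]
    [AddCommGroup E] [Module ℝ E] {f : (ι → E) → ℝ}
    (hf : ∀ p k, ConvexOn ℝ Set.univ fun x => f (Function.update p k x)) {s : Set E}
    {p : ι → E} (hp : ∀ k, p k ∈ convexHull ℝ s) :
    ∃ q : ι → E, (∀ k, q k ∈ s) ∧ f p ≤ f q := by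
  -- The points are moved into s one at a time, never decreasing f.
  suffices h : ∀ t : Finset ι, ∃ q : ι → E,
      (∀ k ∈ t, q k ∈ s) ∧ (∀ k ∉ t, q k = p k) ∧ f p ≤ f q by
    obtain ⟨q, hq, -, hle⟩ := h Finset.univ
    exact ⟨q, fun k => hq k (Finset.mem_univ k), hle⟩
  intro t
  induction t using Finset.induction_on with
  | empty => exact ⟨p, by simp, fun _ _ => rfl, le_rfl⟩
  | insert i t hi ih =>
    obtain ⟨q, hqs, hqp, hle⟩ := ih
    obtain ⟨y, hy, hfy⟩ := (hf q i).exists_ge_of_mem_convexHull (Set.subset_univ s)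
      (x := q i) (by rw [hqp i hi]; exact hp i)
    rw [Function.update_eq_self] at hfy
    refine ⟨Function.update q i y, fun k hk => ?_, fun k hk => ?_, hle.trans hfy⟩
    · by_cases h : k = i
      · subst h; simpa using hy
      · rw [Function.update_of_ne h]
        exact hqs k ((Finset.mem_insert.1 hk).resolve_left h)
    · rw [Finset.mem_insert, not_or] at hk
      rw [Function.update_of_ne hk.1]
      exact hqp k hk.2

theorem unitCube_eq_convexHull (n : ℕ) :
    unitCube n = convexHull ℝ {x : Fin n → ℝ | ∀ i, x i = 0 ∨ x i = 1} := by
  have h : {x : Fin n → ℝ | ∀ i, x i = 0 ∨ x i = 1} =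
      Set.univ.pi fun _ => ({0, 1} : Set ℝ) := by
    ext x
    simp
  rw [h, convexHull_pi]
  ext x
  simp [unitCube, convexHull_pair, segment_eq_Icc, Pi.le_def, forall_and]

theorem abs_det_edgeMatrix_le_maxDet {n : ℕ} {p : Fin (n + 1) → (Fin n → ℝ)}
    (hp : ∀ k, p k ∈ unitCube n) : |(edgeMatrix p).det| ≤ maxDet n := by
  obtain ⟨q, hq, hle⟩ := exists_le_of_forall_convexOn_update
    (f := fun p => |(edgeMatrix p).det|) convexOn_abs_det_edgeMatrix_update
    fun k => unitCube_eq_convexHull n ▸ hp k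
  refine hle.trans ?_
  -- Reflecting the cube so that `q 0` becomes the origin multiplies row i by ±1 and turns the
  -- entries -1, 0, 1 into 0, 1.
  have hmul := Matrix.det_mul_column (fun i => 1 - 2 * q 0 i) (edgeMatrix q)
  have habs : |∏ i, (1 - 2 * q 0 i)| = 1 := by
    rw [Finset.abs_prod]
    refine Finset.prod_eq_one fun i _ => ?_
    rcases hq 0 i with h | h <;> norm_num [h]
  rw [← one_mul |(edgeMatrix q).det|, ← habs, ← abs_mul, ← hmul]
  refine abs_det_le_maxDet fun i j => ?_
  rcases hq 0 i with h | h <;> rcases hq j.succ i with h' | h' <;>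
    norm_num [edgeMatrix, h, h']

theorem cornerVolume_pos (n : ℕ) : 0 < cornerVolume n := by
  have hp := maxSimplexVolume_pos n
  obtain ⟨S, -, hS⟩ := (isGreatest_maxSimplexVolume n).1
  rw [← hS, volume_hull_eq] at hp
  exact pos_of_mul_pos_right hp (abs_nonneg _)

theorem maxSimplexVolume_eq (n : ℕ) : maxSimplexVolume n = maxDet n * cornerVolume n := by
  apply le_antisymm
  · obtain ⟨S, hSc, hS⟩ := (isGreatest_maxSimplexVolume n).1
    rw [← hS, volume_hull_eq]
    exact mul_le_mul_of_nonneg_right (abs_det_edgeMatrix_le_maxDet fun k =>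
      hSc (subset_convexHull ℝ _ ⟨k, rfl⟩)) (cornerVolume_pos n).le
  · obtain ⟨A, hA, hmax⟩ := (isGreatest_maxDet n).1
    let p : Fin (n + 1) → (Fin n → ℝ) := Fin.cons 0 fun j i => A i j
    have hM : edgeMatrix p = A := by
      ext i j
      simp [edgeMatrix, p]
    have hvol : MeasureTheory.volume.real (convexHull ℝ (Set.range p)) =
        maxDet n * cornerVolume n := by
      rw [volume_hull_eq, hM, hmax, abs_of_pos (maxDet_pos n)]
    have hind : AffineIndependent ℝ p := (volume_hull_pos_iff p).1
      (hvol ▸ mul_pos (maxDet_pos n) (cornerVolume_pos n))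
    refine (isGreatest_maxSimplexVolume n).2
      ⟨⟨p, hind⟩, convexHull_min ?_ (convex_unitCube n), hvol⟩
    rintro _ ⟨k, rfl⟩ i
    refine Fin.cases ?_ (fun j => ?_) k
    · simp [p]
    · rcases hA i j with h | h <;> simp [p, h]

/-! ### Corner volumes and conclusion -/

/-- The corner simplex of dimension `n + 1` contains a box `[0, t] × (1 - t) Δ`. -/
theorem mul_cornerVolume_le_cornerVolume_succ (n : ℕ) {t : ℝ} (ht : 0 ≤ t) (ht1 : t ≤ 1) :
    t * (1 - t) ^ n * cornerVolume n ≤ cornerVolume (n + 1) := by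
  open Pointwise in
  let T : Set (Fin n → ℝ) := (1 - t) • convexHull ℝ (Set.range (cornerVertices n))
  let e := MeasurableEquiv.piFinSuccAbove (fun _ : Fin (n + 1) => ℝ) 0
  have hsub : e ⁻¹' (Set.Icc 0 t ×ˢ T) ⊆ convexHull ℝ (Set.range (cornerVertices (n + 1))) := by
    rintro x ⟨⟨hx0, hxt⟩, y, hy, hxy⟩
    rw [convexHull_cornerVertices] at hy ⊢
    have hx : ∀ i : Fin n, (1 - t) * y i = x i.succ := fun i => congrFun hxy i
    refine ⟨fun i => ?_, ?_⟩
    · refine Fin.cases hx0 (fun i => ?_) i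
      rw [← hx i]
      exact mul_nonneg (by linarith) (hy.1 i)
    · rw [Fin.sum_univ_succ, ← Finset.sum_congr rfl fun i _ => hx i, ← Finset.mul_sum]
      have h0 : x 0 ≤ t := hxt
      nlinarith [hy.2]
  have hvol : MeasureTheory.volume.real (e ⁻¹' (Set.Icc 0 t ×ˢ T)) =
      t * (1 - t) ^ n * cornerVolume n := by
    rw [MeasureTheory.measureReal_def,
      (MeasureTheory.volume_preserving_piFinSuccAbove (fun _ : Fin (n + 1) => ℝ)
        0).measure_preimage_equiv, MeasureTheory.Measure.volume_eq_prod,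
      MeasureTheory.Measure.prod_prod, Real.volume_Icc, MeasureTheory.Measure.addHaar_smul,
      ENNReal.toReal_mul, ENNReal.toReal_mul, ENNReal.toReal_ofReal (by linarith),
      ENNReal.toReal_ofReal (abs_nonneg _), Module.finrank_fin_fun,
      abs_of_nonneg (pow_nonneg (by linarith) n), cornerVolume, MeasureTheory.measureReal_def]
    ring
  rw [← hvol]
  exact MeasureTheory.measureReal_mono hsub
    (((Set.finite_range _).isCompact_convexHull ℝ).measure_lt_top.ne)

/-- The box with t = 1/(n + 1), which maximises t(1 - t)ⁿ, suffices: (1 - t)ⁿ is the inverse of (1 +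
1/n)ⁿ ≤ e < 3. The exact value 1/n! is not needed. -/
theorem cornerVolume_le (n : ℕ) : cornerVolume n ≤ 3 * (n + 1) * cornerVolume (n + 1) := by
  have hn : (0 : ℝ) < n + 1 := by positivity
  have h := mul_cornerVolume_le_cornerVolume_succ n (t := ((n : ℝ) + 1)⁻¹) (by positivity)
    (inv_le_one_of_one_le₀ (by linarith [n.cast_nonneg (α := ℝ)]))
  have h3 : 1 ≤ 3 * (1 - ((n : ℝ) + 1)⁻¹) ^ n := by
    rcases n.eq_zero_or_pos with rfl | hpos
    · norm_num
    have hn0 : (0 : ℝ) < n := by exact_mod_cast hpos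
    have he : (1 + (n : ℝ)⁻¹) ^ n ≤ 3 := by
      calc (1 + (n : ℝ)⁻¹) ^ n ≤ Real.exp (n : ℝ)⁻¹ ^ n := by
            gcongr
            rw [add_comm]
            exact Real.add_one_le_exp _
        _ = Real.exp 1 := by rw [← Real.exp_nat_mul, mul_inv_cancel₀ hn0.ne']
        _ ≤ 3 := Real.exp_one_lt_three.le
    have hinv : (1 + (n : ℝ)⁻¹) ^ n * (1 - ((n : ℝ) + 1)⁻¹) ^ n = 1 := by
      rw [← mul_pow, show (1 + (n : ℝ)⁻¹) * (1 - ((n : ℝ) + 1)⁻¹) = 1 by field_simp; ring, one_pow]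
    have : 0 ≤ 1 - ((n : ℝ) + 1)⁻¹ := by
      rw [sub_nonneg]
      exact inv_le_one_of_one_le₀ (by linarith)
    exact hinv.symm.trans_le (mul_le_mul_of_nonneg_right he (pow_nonneg this n))
  calc cornerVolume n ≤ 3 * (1 - ((n : ℝ) + 1)⁻¹) ^ n * cornerVolume n :=
        le_mul_of_one_le_left (cornerVolume_pos n).le h3
    _ = 3 * (n + 1) * (((n : ℝ) + 1)⁻¹ * (1 - ((n : ℝ) + 1)⁻¹) ^ n * cornerVolume n) := by
        field_simp
    _ ≤ 3 * (n + 1) * cornerVolume (n + 1) := by gcongr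

theorem corollary2 :
    ∃ c c₁ : ℝ, 0 < c ∧ 0 < c₁ ∧ ∀ n : ℕ, 1 ≤ n →
      maxDet (n + 1) / maxDet n ≥ c * Real.sqrt (n : ℝ) ∧
      maxSimplexVolume n / maxSimplexVolume (n + 1) ≤ c₁ * Real.sqrt (n : ℝ) := by
  have hs3 : 0 < √(3 : ℝ) := by positivity
  -- Here 4√3 comes from √(n/3)/4, and 24√3 = 3 · 2 · 4√3, the 2 from n + 1 ≤ 2n.
  refine ⟨1 / (4 * √3), 24 * √3, by positivity, by positivity, fun n hn => ?_⟩
  have hn1 : (1 : ℝ) ≤ n := by exact_mod_cast hn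
  have hd := maxDet_mul_sqrt_le_maxDet_succ n
  have hdn := maxDet_pos n
  have hdn1 := maxDet_pos (n + 1)
  rw [Real.sqrt_div (by positivity)] at hd
  have hsn : 0 < √(n : ℝ) := Real.sqrt_pos.2 (by linarith)
  refine ⟨?_, ?_⟩
  · rw [ge_iff_le, le_div_iff₀ hdn]
    refine le_trans (le_of_eq ?_) hd
    field_simp
  · rw [div_le_iff₀ (maxSimplexVolume_pos _), maxSimplexVolume_eq, maxSimplexVolume_eq]
    have hsq : √(n : ℝ) * √n = n := Real.mul_self_sqrt (by positivity)
    have hc := (cornerVolume_pos (n + 1)).le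
    have hd' : maxDet n * √n ≤ 4 * √3 * maxDet (n + 1) := by
      refine le_trans (le_of_eq ?_) (mul_le_mul_of_nonneg_left hd (by positivity))
      field_simp
    calc maxDet n * cornerVolume n ≤ maxDet n * (3 * (n + 1) * cornerVolume (n + 1)) := by
          gcongr
          exact cornerVolume_le n
      _ ≤ maxDet n * (3 * (n + n) * cornerVolume (n + 1)) := by gcongr
      _ = 6 * √n * (maxDet n * √n) * cornerVolume (n + 1) := by
          linear_combination -6 * maxDet n * cornerVolume (n + 1) * hsq
      _ ≤ 6 * √n * (4 * √3 * maxDet (n + 1)) * cornerVolume (n + 1) := by gcongr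
      _ = _ := by ring
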